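/- Let $\mathcal X$ be a measurable space. A prediction function is a measurable map $g:\mathcal X\to\{0,1\}$; its risk under a probability distribution $P$ on $\mathcal X\times\{0,1\}$ is $R_P(g)=P(Y\neq g(X))$. For $n\in\mathbb N=\{0,1,2,\dots\}$, an estimator $\hat g$ maps (measurably) a training set $Z_1^n\in(\mathcal X\times\{0,1\})^n$ to a prediction function, or, if it is randomized, to a probability distribution on prediction functions. $\mathbb E R_P(\hat g)$ denotes its expected risk when $Z_1,\dots,Z_n$ are drawn independently from $P$ (the expectation being also over the internal randomization, if any). **Theorem 8.8.** Let $L\in[0,1/2]$, let $n\in\mathbb N$, and let $\mathcal G$ be a set of prediction functions of VC-dimension $V$ with $2\le V<\infty$. Let $\mathcal P_L$ be the set of probability distributions $P$ on $\mathcal X\times\{0,1\}$ such that $\inf_{g\in\mathcal G}R_P(g)=L$. Then for any estimator $\hat g$: - when $L=0$, there exists $P\in\mathcal P_0$ for which $$\mathbb E R_P(\hat g)-\inf_{g\in\mathcal G}R_P(g)\ \ge\ \begin{cases}\dfrac{V-1}{2e(n+1)} & \text{when } n\ge V-2,\\[2mm] \dfrac12\Big(1-\dfrac1V\Big)^n &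 \text{otherwise;}\end{cases}$$ - when $0<L\le 1/2$, there exists $P\in\mathcal P_L$ for which $$\mathbb E R_P(\hat g)-\inf_{g\in\mathcal G}R_P(g)\ \ge\ \begin{cases}\sqrt{\dfrac{L(V-1)}{32n}}\ \vee\ \dfrac{2(V-1)}{27n} & \text{when } \dfrac{(1-2L)^2n}{V}\ge\dfrac49,\\[2mm] \dfrac{1-2L}{6} & \text{otherwise;}\end{cases}$$ - there exists a probability distribution $P$ on $\mathcal X\times\{0,1\}$ for which $$\mathbb E R_P(\hat g)-\inf_{g\in\mathcal G}R_P(g)\ \ge\ \begin{cases}\dfrac18\sqrt{\dfrac Vn} & \text{when } n\ge \dfrac V4,\\[2mm] \dfrac14 & \text{otherwise.}\end{cases}$$ -/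

import Mathlib

open MeasureTheory ProbabilityTheory

universe u v

/-- A class `𝒢` of `{0, 1}`-valued functions (`Bool` plays the role of `{0, 1}`) shatters the finite
set `S` if every labelling of the points of `S` is realised by some member of `𝒢`. -/
def ClassShatters {X : Type u} (𝒢 : Set (X → Bool)) (S : Finset X) : Prop :=
  ∀ label : X → Bool, ∃ g ∈ 𝒢, ∀ x ∈ S, g x = label x

/-- `𝒢` has VC-dimension exactly `V`: the largest number of points it shatters is `V`. -/
def HasVCDimension {X : Type u} (𝒢 : Set (X → Bool)) (V : ℕ) : Prop :=
  IsGreatest {k : ℕ | ∃ S : Finset X, S.card = k ∧ ClassShatters 𝒢 S} V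

/-- The risk `R(g) = P(Y ≠ g(X))` of a prediction function for the loss `1_{y ≠ y'}`. -/
noncomputable def classRisk {X : Type u} [MeasurableSpace X] (P : Measure (X × Bool))
    (g : X → Bool) : ℝ :=
  P.real {z : X × Bool | z.2 ≠ g z.1}

/-- `inf_{g ∈ 𝒢} R(g)`. The set of risks is bounded below by `0`, so this is the true infimum
as soon as `𝒢` is nonempty. -/
noncomputable def bestRisk {X : Type u} [MeasurableSpace X] (𝒢 : Set (X → Bool))
    (P : Measure (X × Bool)) : ℝ :=
  sInf (classRisk P '' 𝒢)

/-- A (possibly randomized) estimator for training sets of size `n`: to a training set it assigns,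
measurably, a probability distribution on prediction functions. The prediction functions it may
output form a jointly measurable family `pred θ`, indexed by a measurable space `Index`.
A deterministic estimator, i.e. a jointly measurable map `(z, x) ↦ ĝ_z(x)`, is the case where
`Index` is the space of training sets, `pred = ĝ` and `law` is the identity kernel. -/
structure ClassEstimator (X : Type u) [MeasurableSpace X] (n : ℕ) where
  Index : Type v
  [measurableSpaceIndex : MeasurableSpace Index]
  pred : Index → X → Bool
  measurable_pred : Measurable fun p : Index × X => pred p.1 p.2
  law : Kernel (Fin n → X × Bool) Index
  [isMarkovKernel_law : IsMarkovKernel law]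

attribute [instance] ClassEstimator.measurableSpaceIndex ClassEstimator.isMarkovKernel_law

/-- The expected risk `𝔼 R(ĝ)` when the training set consists of `n` independent draws from `P`;
the expectation is over the training set and over the internal randomization of the estimator. -/
noncomputable def ClassEstimator.expectedRisk {X : Type u} [MeasurableSpace X] {n : ℕ}
    (ghat : ClassEstimator.{u, v} X n) (P : Measure (X × Bool)) : ℝ :=
  ∫ z, ∫ θ, classRisk P (ghat.pred θ) ∂(ghat.law z) ∂(Measure.pi fun _ : Fin n => P)

/-- The excess risk `𝔼 R(ĝ) - inf_{g ∈ 𝒢} R(g)`. -/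
noncomputable def ClassEstimator.excessRisk {X : Type u} [MeasurableSpace X] {n : ℕ}
    (ghat : ClassEstimator.{u, v} X n) (𝒢 : Set (X → Bool)) (P : Measure (X × Bool)) : ℝ :=
  ghat.expectedRisk P - bestRisk 𝒢 P

/-- The set `𝒫_L` of probability distributions on `X × {0, 1}` with `inf_{g ∈ 𝒢} R(g) = L`. -/
def distributionsOfLevel {X : Type u} [MeasurableSpace X] (𝒢 : Set (X → Bool)) (L : ℝ) :
    Set (Measure (X × Bool)) :=
  {P | IsProbabilityMeasure P ∧ bestRisk 𝒢 P = L}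

/-! This is Assouad's method on a shattered set. Put a marginal `μ` on the shattered points and let
the label at point `i` agree with a hidden bit `σ i` with probability `(1 + ξ i) / 2`. Some member
of the class realises `σ`, so the best risk does not depend on `σ`, and the excess risk is the sum
over `i` of `μ i * ξ i` times the probability of missing `σ i`.

Flipping `σ i` gives two training laws whose miss probabilities sum to at least the overlap of the
laws (Le Cam). Given the positions, the squared Hellinger affinity is `(1 - ξ i ^ 2) ^ N`, with `N`
the number of draws at `i`. Averaging over positions bounds the overlap below by `1 - √(n * μ i * ξ
i ^ 2)`, or gives exactly `(1 - μ i) ^ n` when `ξ i = 1`; averaging over `σ` then yields one bad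
labelling.

Each bound is a choice of `μ` and `ξ`: uniform, or equal masses on all points but one, whose own
bias tunes the best risk to `L`. -/

/-! ### Affinity and overlap. -/

/-- Two distributions on a finite set overlap by at least a function of their Hellinger affinity. -/
theorem one_sub_sqrt_le_sum_min {κ : Type*} [Fintype κ] {A B : κ → ℝ} (hA : ∀ y, 0 ≤ A y)
    (hB : ∀ y, 0 ≤ B y) (sA : ∑ y, A y = 1) (sB : ∑ y, B y = 1) :
    1 - √(1 - (∑ y, √(A y * B y)) ^ 2) ≤ ∑ y, min (A y) (B y) := by
  set a := ∑ y, √(A y * B y) with ha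
  have h1 : ∑ y, (√(A y) - √(B y)) ^ 2 = 2 - 2 * a := by
    have : ∀ y, (√(A y) - √(B y)) ^ 2 = A y + B y - 2 * √(A y * B y) := fun y => by
      rw [Real.sqrt_mul (hA y), sub_sq, Real.sq_sqrt (hA y), Real.sq_sqrt (hB y)]; ring
    simp only [this, Finset.sum_sub_distrib, Finset.sum_add_distrib, sA, sB, ← Finset.mul_sum]
    ring
  have h2 : ∑ y, (√(A y) + √(B y)) ^ 2 = 2 + 2 * a := by
    have : ∀ y, (√(A y) + √(B y)) ^ 2 = A y + B y + 2 * √(A y * B y) := fun y => by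
      rw [Real.sqrt_mul (hA y), add_sq, Real.sq_sqrt (hA y), Real.sq_sqrt (hB y)]; ring
    simp only [this, Finset.sum_add_distrib, sA, sB, ← Finset.mul_sum]
    ring
  have h3 : ∑ y, |√(A y) - √(B y)| * (√(A y) + √(B y)) = 2 - 2 * ∑ y, min (A y) (B y) := by
    have : ∀ y, |√(A y) - √(B y)| * (√(A y) + √(B y)) = A y + B y - 2 * min (A y) (B y) :=
      fun y => by
        have e : (√(A y) - √(B y)) * (√(A y) + √(B y)) = A y - B y := by
          rw [← Real.mul_self_sqrt (hA y), ← Real.mul_self_sqrt (hB y)]; simp; ring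
        have hp : 0 ≤ √(A y) + √(B y) := by positivity
        rw [show √(A y) + √(B y) = |√(A y) + √(B y)| from (abs_of_nonneg hp).symm, ← abs_mul, e]
        rcases le_total (A y) (B y) with h | h
        · rw [min_eq_left h, abs_of_nonpos (by linarith)]; ring
        · rw [min_eq_right h, abs_of_nonneg (by linarith)]; ring
    simp only [this, Finset.sum_sub_distrib, Finset.sum_add_distrib, sA, sB, ← Finset.mul_sum]
    ring
  -- Cauchy–Schwarz on `|A - B| = |√A - √B| (√A + √B)` gives `(1 - ∑ min)² ≤ (1 - a)(1 + a)`.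
  have cs := Finset.sum_mul_sq_le_sq_mul_sq Finset.univ (fun y => |√(A y) - √(B y)|)
    (fun y => √(A y) + √(B y))
  simp only [sq_abs, h1, h2, h3] at cs
  have : 1 - ∑ y, min (A y) (B y) ≤ √(1 - a ^ 2) := Real.le_sqrt_of_sq_le (by nlinarith)
  linarith

theorem sum_prod_eq_one {ι : Type*} [Fintype ι] {μ : ι → ℝ} (hμ1 : ∑ i, μ i = 1) (n : ℕ) :
    ∑ x : Fin n → ι, ∏ j, μ (x j) = 1 := by
  rw [← Fintype.sum_pow, hμ1, one_pow]

/-! ### Le Cam and Assouad bounds for hidden labels. -/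

/-- The probability of label `z.2` at the point `z.1` when the label `σ z.1` is favoured with
bias `ξ z.1`. -/
noncomputable def labelProb {ι : Type*} (ξ : ι → ℝ) (σ : ι → Bool) (z : ι × Bool) : ℝ :=
  if z.2 = σ z.1 then (1 + ξ z.1) / 2 else (1 - ξ z.1) / 2

section

variable {ι : Type*} {ξ : ι → ℝ}

theorem labelProb_nonneg (hξ : ∀ i, ξ i ∈ Set.Icc (0 : ℝ) 1) (σ : ι → Bool) (z : ι × Bool) :
    0 ≤ labelProb ξ σ z := by
  have := hξ z.1
  unfold labelProb
  split_ifs <;> linarith [this.1, this.2]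

theorem sum_labelProb (σ : ι → Bool) (i : ι) : ∑ b, labelProb ξ σ (i, b) = 1 := by
  cases h : σ i <;> simp [labelProb, h] <;> ring

theorem sum_sqrt_labelProb_mul_update [DecidableEq ι] (hξ : ∀ i, ξ i ∈ Set.Icc (0 : ℝ) 1)
    (σ : ι → Bool) (i k : ι) :
    ∑ b, √(labelProb ξ σ (k, b) * labelProb ξ (Function.update σ i (!σ i)) (k, b)) =
      √(if k = i then 1 - ξ i ^ 2 else 1) := by
  by_cases hk : k = i
  · subst hk
    have e : (1 + ξ k) / 2 * ((1 - ξ k) / 2) = (1 - ξ k ^ 2) * (1 / 2) ^ 2 := by ring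
    have e' : (1 - ξ k) / 2 * ((1 + ξ k) / 2) = (1 - ξ k ^ 2) * (1 / 2) ^ 2 := by ring
    have h0 : 0 ≤ 1 - ξ k ^ 2 := by nlinarith [(hξ k).1, (hξ k).2]
    have s : √((1 - ξ k ^ 2) * (1 / 2) ^ 2) = √(1 - ξ k ^ 2) * (1 / 2) := by
      rw [Real.sqrt_mul h0, Real.sqrt_sq (by norm_num)]
    cases h : σ k <;> simp only [labelProb, h, Function.update_self, Fintype.sum_bool, if_true,
      Bool.not_true, Bool.not_false, reduceCtorEq, if_false, e, e', s] <;> ring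
  · have : ∀ b, labelProb ξ (Function.update σ i (!σ i)) (k, b) = labelProb ξ σ (k, b) :=
      fun b => by simp [labelProb, hk]
    simp only [this, Real.sqrt_mul_self (labelProb_nonneg hξ σ _), sum_labelProb, if_neg hk,
      Real.sqrt_one]

/-- The average over the positions of `n` points drawn from `μ` of a lower bound for the overlap of
the two laws of the labels that differ in the label favoured at `i`. -/
noncomputable def avgOverlap [Fintype ι] [DecidableEq ι] (n : ℕ) (μ ξ : ι → ℝ) (i : ι) : ℝ :=
  ∑ x : Fin n → ι, (∏ j, μ (x j)) * (1 - √(1 - ∏ j, if x j = i then 1 - ξ i ^ 2 else 1))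

variable [Fintype ι] [DecidableEq ι] {n : ℕ} {μ : ι → ℝ}

/-- The draws are independent, so this generating function of the number of visits to `i`
factorises. -/
theorem sum_prod_mul_prod_ite (hμ1 : ∑ i, μ i = 1) (n : ℕ) (i : ι) (c : ℝ) :
    ∑ x : Fin n → ι, (∏ j, μ (x j)) * ∏ j, (if x j = i then 1 - c else 1) = (1 - μ i * c) ^ n := by
  simp only [← Finset.prod_mul_distrib]
  rw [← Fintype.sum_pow (fun k => μ k * if k = i then 1 - c else 1)]
  congr 1
  have : ∀ k, (μ k * if k = i then 1 - c else 1) = μ k - if k = i then μ k * c else 0 := by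
    intro k; split_ifs <;> ring
  simp [this, hμ1]

/-- Concavity of the root (via Cauchy–Schwarz) moves the average over positions inside it;
Bernoulli's inequality then linearises the power. -/
theorem one_sub_sqrt_le_avgOverlap (hμ : ∀ i, 0 ≤ μ i) (hμ1 : ∑ i, μ i = 1)
    (hξ : ∀ i, ξ i ∈ Set.Icc (0 : ℝ) 1) (i : ι) :
    1 - √(n * μ i * ξ i ^ 2) ≤ avgOverlap n μ ξ i := by
  have hx : ξ i ^ 2 ≤ 1 := by nlinarith [(hξ i).1, (hξ i).2]
  set w : (Fin n → ι) → ℝ := fun x => ∏ j, μ (x j) with hw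
  set t : (Fin n → ι) → ℝ := fun x => 1 - ∏ j, if x j = i then 1 - ξ i ^ 2 else 1 with ht
  have hw0 : ∀ x, 0 ≤ w x := fun x => Finset.prod_nonneg fun j _ => hμ _
  have ht0 : ∀ x, 0 ≤ t x := fun x => by
    simp only [ht, sub_nonneg]
    refine Finset.prod_le_one (fun j _ => ?_) (fun j _ => ?_) <;> split_ifs <;>
      nlinarith [sq_nonneg (ξ i)]
  have hμi : μ i ≤ 1 := hμ1 ▸ Finset.single_le_sum (fun k _ => hμ k) (Finset.mem_univ i)
  have hw1 : ∑ x, w x = 1 := sum_prod_eq_one hμ1 n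
  have hwt : ∑ x, w x * t x = 1 - (1 - μ i * ξ i ^ 2) ^ n := by
    simp only [ht, mul_sub, mul_one, Finset.sum_sub_distrib, hw1]
    rw [sum_prod_mul_prod_ite hμ1]
  have hb : 1 - (1 - μ i * ξ i ^ 2) ^ n ≤ n * μ i * ξ i ^ 2 := by
    have := one_add_mul_le_pow (a := -(μ i * ξ i ^ 2)) (by nlinarith [hμ i, sq_nonneg (ξ i)]) n
    rw [← sub_eq_add_neg] at this
    linarith
  have cs := Finset.sum_mul_sq_le_sq_mul_sq Finset.univ (fun x => √(w x))
    (fun x => √(w x) * √(t x))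
  have e1 : ∀ x, √(w x) * (√(w x) * √(t x)) = w x * √(t x) := fun x => by
    rw [← mul_assoc, Real.mul_self_sqrt (hw0 x)]
  simp only [e1, mul_pow, Real.sq_sqrt (hw0 _), Real.sq_sqrt (ht0 _), hw1, hwt, one_mul] at cs
  have h := Real.le_sqrt_of_sq_le (cs.trans hb)
  have : avgOverlap n μ ξ i = 1 - ∑ x, w x * √(t x) := by
    rw [← hw1]
    simp only [avgOverlap, mul_sub, mul_one, Finset.sum_sub_distrib]
    rfl
  linarith

/-- Without noise, one visit to `i` reveals its label, so only samples missing `i` contribute. -/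
theorem avgOverlap_of_bias_eq_one (hμ1 : ∑ i, μ i = 1) {i : ι} (hi : ξ i = 1) :
    avgOverlap n μ ξ i = (1 - μ i) ^ n := by
  rw [← mul_one (μ i), ← sum_prod_mul_prod_ite hμ1]
  refine Finset.sum_congr rfl fun x _ => ?_
  congr 1
  simp only [hi, one_pow, sub_self]
  by_cases h : ∃ j, x j = i
  · obtain ⟨j, hj⟩ := h
    have : ∏ j, (if x j = i then (0 : ℝ) else 1) = 0 :=
      Finset.prod_eq_zero (Finset.mem_univ j) (if_pos hj)
    simp [this]
  · push Not at h
    simp [h]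

theorem avgOverlap_nonneg (hμ : ∀ i, 0 ≤ μ i) (hξ : ∀ i, ξ i ∈ Set.Icc (0 : ℝ) 1) (i : ι) :
    0 ≤ avgOverlap n μ ξ i := by
  refine Finset.sum_nonneg fun x _ => mul_nonneg (Finset.prod_nonneg fun j _ => hμ _) ?_
  have : 0 ≤ ∏ j, if x j = i then 1 - ξ i ^ 2 else 1 := Finset.prod_nonneg fun j _ => by
    split_ifs <;> nlinarith [(hξ i).1, (hξ i).2]
  exact sub_nonneg.2 (Real.sqrt_le_one.2 (by linarith))

/-- Le Cam's two-point bound for the problem of guessing the label favoured at `i`. -/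
theorem avgOverlap_le_error_add_error (hμ : ∀ i, 0 ≤ μ i) (hξ : ∀ i, ξ i ∈ Set.Icc (0 : ℝ) 1)
    (e : Bool → (Fin n → ι × Bool) → ℝ) (he : ∀ b z, 0 ≤ e b z)
    (he1 : ∀ b z, e b z + e (!b) z = 1) (i : ι) (σ : ι → Bool) :
    avgOverlap n μ ξ i ≤
      ∑ z, (∏ j, μ (z j).1 * labelProb ξ σ (z j)) * e (σ i) z +
      ∑ z, (∏ j, μ (z j).1 * labelProb ξ (Function.update σ i (!σ i)) (z j)) * e (!σ i) z := by
  set τ := Function.update σ i (!σ i) with hτ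
  rw [← Finset.sum_add_distrib,
    ← (Equiv.arrowProdEquivProdArrow (Fin n) (fun _ => ι) (fun _ => Bool)).symm.sum_comp,
    Fintype.sum_prod_type]
  -- The positions have the same law under both labellings, so it suffices to compare label laws at
  -- fixed positions.
  refine Finset.sum_le_sum fun x _ => ?_
  have hx : 0 ≤ ∏ j, μ (x j) := Finset.prod_nonneg fun j _ => hμ _
  set A : (Fin n → Bool) → ℝ := fun y => ∏ j, labelProb ξ σ (x j, y j) with hA
  set B : (Fin n → Bool) → ℝ := fun y => ∏ j, labelProb ξ τ (x j, y j) with hB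
  have hA0 : ∀ y, 0 ≤ A y := fun y => Finset.prod_nonneg fun j _ => labelProb_nonneg hξ _ _
  have hB0 : ∀ y, 0 ≤ B y := fun y => Finset.prod_nonneg fun j _ => labelProb_nonneg hξ _ _
  have sA : ∑ y, A y = 1 := by
    simp only [hA, ← Fintype.prod_sum fun (j : Fin n) b => labelProb ξ σ (x j, b), sum_labelProb,
      Finset.prod_const_one]
  have sB : ∑ y, B y = 1 := by
    simp only [hB, ← Fintype.prod_sum fun (j : Fin n) b => labelProb ξ τ (x j, b), sum_labelProb,
      Finset.prod_const_one]
  have hn : ∀ j, (0 : ℝ) ≤ if x j = i then 1 - ξ i ^ 2 else 1 := fun j => by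
    split_ifs <;> nlinarith [(hξ i).1, (hξ i).2]
  have sAB : (∑ y, √(A y * B y)) ^ 2 = ∏ j, if x j = i then 1 - ξ i ^ 2 else 1 := by
    have : ∀ y, √(A y * B y) =
        ∏ j, √(labelProb ξ σ (x j, y j) * labelProb ξ τ (x j, y j)) := fun y => by
      simp only [hA, hB]
      rw [← Finset.prod_mul_distrib, Real.sqrt_prod _ fun j _ =>
        mul_nonneg (labelProb_nonneg hξ _ _) (labelProb_nonneg hξ _ _)]
    simp only [this]
    rw [← Fintype.prod_sum fun (j : Fin n) b =>
      √(labelProb ξ σ (x j, b) * labelProb ξ τ (x j, b)), ← Finset.prod_pow]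
    refine Finset.prod_congr rfl fun j _ => ?_
    rw [sum_sqrt_labelProb_mul_update hξ, Real.sq_sqrt (hn j)]
  refine (mul_le_mul_of_nonneg_left ((sAB ▸ one_sub_sqrt_le_sum_min hA0 hB0 sA sB)) hx).trans ?_
  rw [Finset.mul_sum]
  refine Finset.sum_le_sum fun y _ => ?_
  set z := (Equiv.arrowProdEquivProdArrow (Fin n) (fun _ => ι) (fun _ => Bool)).symm (x, y) with hz
  have e1 : ∏ j, μ (z j).1 * labelProb ξ σ (z j) = (∏ j, μ (x j)) * A y := by
    rw [hA, ← Finset.prod_mul_distrib]; rfl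
  have e2 : ∏ j, μ (z j).1 * labelProb ξ τ (z j) = (∏ j, μ (x j)) * B y := by
    rw [hB, ← Finset.prod_mul_distrib]; rfl
  rw [e1, e2, mul_assoc, mul_assoc, ← mul_add]
  refine mul_le_mul_of_nonneg_left ?_ hx
  have h := he1 (σ i) z
  calc min (A y) (B y) = min (A y) (B y) * e (σ i) z + min (A y) (B y) * e (!σ i) z := by
        rw [← mul_add, h, mul_one]
    _ ≤ _ := add_le_add (mul_le_mul_of_nonneg_right (min_le_left _ _) (he _ _))
        (mul_le_mul_of_nonneg_right (min_le_right _ _) (he _ _))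

/-- Assouad's lemma for the hypercube of labellings. -/
theorem exists_labelling_avgOverlap_le (hμ : ∀ i, 0 ≤ μ i) (hξ : ∀ i, ξ i ∈ Set.Icc (0 : ℝ) 1)
    (e : ι → Bool → (Fin n → ι × Bool) → ℝ) (he : ∀ i b z, 0 ≤ e i b z)
    (he1 : ∀ i b z, e i b z + e i (!b) z = 1) :
    ∃ σ : ι → Bool, ∑ i, μ i * ξ i / 2 * avgOverlap n μ ξ i ≤
      ∑ i, μ i * ξ i * ∑ z, (∏ j, μ (z j).1 * labelProb ξ σ (z j)) * e i (σ i) z := by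
  have key : ∑ _σ : ι → Bool, ∑ i, μ i * ξ i / 2 * avgOverlap n μ ξ i ≤
      ∑ σ : ι → Bool,
        ∑ i, μ i * ξ i * ∑ z, (∏ j, μ (z j).1 * labelProb ξ σ (z j)) * e i (σ i) z := by
    rw [Finset.sum_comm, Finset.sum_comm (s := (Finset.univ : Finset (ι → Bool)))]
    refine Finset.sum_le_sum fun i _ => ?_
    -- Flipping bit `i` permutes the cube, so summing the two-point bound over `σ` counts each error
    -- twice: hence the factor `1 / 2`.
    have inv : Function.Involutive fun σ : ι → Bool => Function.update σ i (!σ i) := fun σ => by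
      simp
    set F : (ι → Bool) → ℝ := fun σ =>
      ∑ z, (∏ j, μ (z j).1 * labelProb ξ σ (z j)) * e i (σ i) z with hF
    have hflip : ∑ σ, F (Function.update σ i (!σ i)) = ∑ σ, F σ := Equiv.sum_comp inv.toPerm F
    have hle : ∑ _σ : ι → Bool, avgOverlap n μ ξ i ≤ ∑ σ, (F σ + F (Function.update σ i (!σ i))) :=
      Finset.sum_le_sum fun σ _ => by
        simpa [hF] using avgOverlap_le_error_add_error hμ hξ (e i) (he i) (he1 i) i σ
    rw [Finset.sum_add_distrib, hflip] at hle
    rw [← Finset.mul_sum, ← Finset.mul_sum]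
    nlinarith [mul_nonneg (hμ i) (hξ i).1]
  obtain ⟨σ, -, h⟩ := Finset.exists_le_of_sum_le Finset.univ_nonempty key
  exact ⟨σ, h⟩

end

/-! ### Transfer to measures on `X × Bool` and to estimators. -/

section

variable {ι : Type*} [Fintype ι] {μ ξ : ι → ℝ}

theorem sum_mul_labelProb (hμ1 : ∑ i, μ i = 1) (σ : ι → Bool) :
    ∑ z : ι × Bool, μ z.1 * labelProb ξ σ z = 1 := by
  simp only [Fintype.sum_prod_type, ← Finset.mul_sum, sum_labelProb, mul_one, hμ1]

/-- The law on `ι × Bool` with first marginal `μ` and conditional label probabilities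
`labelProb ξ σ`. -/
noncomputable def labelPMF (hμ : ∀ i, 0 ≤ μ i) (hμ1 : ∑ i, μ i = 1)
    (hξ : ∀ i, ξ i ∈ Set.Icc (0 : ℝ) 1) (σ : ι → Bool) : PMF (ι × Bool) :=
  PMF.ofFintype (fun z => ENNReal.ofReal (μ z.1 * labelProb ξ σ z)) <| by
    rw [← ENNReal.ofReal_sum_of_nonneg fun z _ => mul_nonneg (hμ _) (labelProb_nonneg hξ _ _),
      sum_mul_labelProb hμ1, ENNReal.ofReal_one]

variable [MeasurableSpace ι] [MeasurableSingletonClass ι] {X : Type u} [MeasurableSpace X]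
  (hμ : ∀ i, 0 ≤ μ i) (hμ1 : ∑ i, μ i = 1) (hξ : ∀ i, ξ i ∈ Set.Icc (0 : ℝ) 1) (σ : ι → Bool)
  (x : ι → X)

/-- The law on `X × Bool` carried by the points `x i`. -/
noncomputable def labelMeasure : Measure (X × Bool) :=
  (labelPMF hμ hμ1 hξ σ).toMeasure.map (Prod.map x id)

theorem measurable_prodMap_id : Measurable (Prod.map x (id : Bool → Bool)) := .of_discrete

theorem isProbabilityMeasure_labelMeasure : IsProbabilityMeasure (labelMeasure hμ hμ1 hξ σ x) :=
  Measure.isProbabilityMeasure_map (measurable_prodMap_id x).aemeasurable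

theorem real_labelPMF_singleton (z : ι × Bool) :
    (labelPMF hμ hμ1 hξ σ).toMeasure.real {z} = μ z.1 * labelProb ξ σ z := by
  rw [measureReal_def, PMF.toMeasure_apply_singleton _ _ (measurableSet_singleton z), labelPMF,
    PMF.ofFintype_apply, ENNReal.toReal_ofReal (mul_nonneg (hμ _) (labelProb_nonneg hξ _ _))]

/-- Predicting the favoured label at `x i` errs with probability `(1 - ξ i) / 2`; the other label
adds `ξ i`. -/
theorem classRisk_labelMeasure {g : X → Bool} (hg : Measurable g) :
    classRisk (labelMeasure hμ hμ1 hξ σ x) g =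
      ∑ i, μ i * (1 - ξ i) / 2 + ∑ i, μ i * ξ i * if g (x i) ≠ σ i then 1 else 0 := by
  have hs : MeasurableSet {z : X × Bool | z.2 ≠ g z.1} :=
    (measurableSet_eq_fun measurable_snd (hg.comp measurable_fst)).compl
  rw [classRisk, labelMeasure, map_measureReal_apply (measurable_prodMap_id x) hs,
    ← integral_indicator_one ((measurable_prodMap_id x) hs), integral_fintype .of_finite,
    Fintype.sum_prod_type, ← Finset.sum_add_distrib]
  refine Finset.sum_congr rfl fun i _ => ?_
  have hind : ∀ b, (Prod.map x id ⁻¹' {z : X × Bool | z.2 ≠ g z.1}).indicator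
      (1 : ι × Bool → ℝ) (i, b) = if b ≠ g (x i) then 1 else 0 := fun b => by
    by_cases hb : b = g (x i) <;> simp [Set.indicator, hb]
  simp only [real_labelPMF_singleton, Fintype.sum_bool, hind, labelProb, smul_eq_mul]
  cases g (x i) <;> cases σ i <;> simp <;> ring

theorem integral_pi_labelMeasure {n : ℕ} {f : (Fin n → X × Bool) → ℝ} (hf : Measurable f) :
    ∫ z, f z ∂(Measure.pi fun _ : Fin n => labelMeasure hμ hμ1 hξ σ x) =
      ∑ z : Fin n → ι × Bool, (∏ j, μ (z j).1 * labelProb ξ σ (z j)) *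
        f fun j => Prod.map x id (z j) := by
  have hm : Measurable fun (z : Fin n → ι × Bool) j => Prod.map x id (z j) := .of_discrete
  have := isProbabilityMeasure_labelMeasure hμ hμ1 hξ σ x
  unfold labelMeasure at this ⊢
  rw [← Measure.pi_map_pi fun _ => (measurable_prodMap_id x).aemeasurable,
    integral_map hm.aemeasurable hf.aestronglyMeasurable, integral_fintype .of_finite]
  refine Finset.sum_congr rfl fun z _ => ?_
  rw [measureReal_def, Measure.pi_singleton, ENNReal.toReal_prod, smul_eq_mul]
  congr 1
  exact Finset.prod_congr rfl fun j _ => real_labelPMF_singleton hμ hμ1 hξ σ (z j)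

theorem bestRisk_labelMeasure {𝒢 : Set (X → Bool)} (h𝒢 : ∀ g ∈ 𝒢, Measurable g)
    (hx : ∀ l : ι → Bool, ∃ g ∈ 𝒢, ∀ i, g (x i) = l i) :
    bestRisk 𝒢 (labelMeasure hμ hμ1 hξ σ x) = ∑ i, μ i * (1 - ξ i) / 2 := by
  refine IsLeast.csInf_eq ⟨?_, ?_⟩
  · obtain ⟨g, hg, h⟩ := hx σ
    refine ⟨g, hg, ?_⟩
    simp [classRisk_labelMeasure hμ hμ1 hξ σ x (h𝒢 g hg), h]
  · rintro _ ⟨g, hg, rfl⟩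
    rw [classRisk_labelMeasure hμ hμ1 hξ σ x (h𝒢 g hg)]
    refine le_add_of_nonneg_right (Finset.sum_nonneg fun i _ =>
      mul_nonneg (mul_nonneg (hμ i) (hξ i).1) ?_)
    split_ifs <;> norm_num

variable {n : ℕ} (ghat : ClassEstimator.{u, v} X n)

/-- The probability that the estimator does not predict `b` at `y` when trained on `z`. -/
noncomputable def ClassEstimator.missProb (y : X) (b : Bool) (z : Fin n → X × Bool) : ℝ :=
  (ghat.law z).real {θ | ghat.pred θ y ≠ b}

theorem ClassEstimator.measurable_pred_right (y : X) : Measurable fun θ => ghat.pred θ y :=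
  ghat.measurable_pred.comp (measurable_id.prodMk measurable_const)

theorem ClassEstimator.measurableSet_miss (y : X) (b : Bool) :
    MeasurableSet {θ | ghat.pred θ y ≠ b} :=
  (ghat.measurable_pred_right y) (MeasurableSet.of_discrete (s := {b}ᶜ))

theorem ClassEstimator.measurable_missProb (y : X) (b : Bool) :
    Measurable (ghat.missProb y b) :=
  (ghat.law.measurable_coe (ghat.measurableSet_miss y b)).ennreal_toReal

theorem ClassEstimator.missProb_add_not (y : X) (b : Bool) (z : Fin n → X × Bool) :
    ghat.missProb y b z + ghat.missProb y (!b) z = 1 := by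
  have : {θ | ghat.pred θ y ≠ !b} = {θ | ghat.pred θ y ≠ b}ᶜ := by
    ext θ
    cases h : ghat.pred θ y <;> cases b <;> simp [h]
  rw [missProb, missProb, this, probReal_compl_eq_one_sub (ghat.measurableSet_miss y b)]
  ring

/-- The noise part of the risk is exactly the best risk and cancels. -/
theorem ClassEstimator.excessRisk_labelMeasure {𝒢 : Set (X → Bool)} (h𝒢 : ∀ g ∈ 𝒢, Measurable g)
    (hx : ∀ l : ι → Bool, ∃ g ∈ 𝒢, ∀ i, g (x i) = l i) :
    ghat.excessRisk 𝒢 (labelMeasure hμ hμ1 hξ σ x) =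
      ∑ i, μ i * ξ i * ∑ z : Fin n → ι × Bool, (∏ j, μ (z j).1 * labelProb ξ σ (z j)) *
        ghat.missProb (x i) (σ i) fun j => Prod.map x id (z j) := by
  have hin : ∀ z, ∫ θ, classRisk (labelMeasure hμ hμ1 hξ σ x) (ghat.pred θ) ∂(ghat.law z) =
      ∑ i, μ i * (1 - ξ i) / 2 + ∑ i, μ i * ξ i * ghat.missProb (x i) (σ i) z := by
    intro z
    have hpt : ∀ θ, classRisk (labelMeasure hμ hμ1 hξ σ x) (ghat.pred θ) =
        ∑ i, μ i * (1 - ξ i) / 2 + ∑ i, μ i * ξ i *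
          {θ | ghat.pred θ (x i) ≠ σ i}.indicator (1 : ghat.Index → ℝ) θ := fun θ => by
      rw [classRisk_labelMeasure hμ hμ1 hξ σ x
        (show Measurable (ghat.pred θ) from ghat.measurable_pred.comp measurable_prodMk_left)]
      simp [Set.indicator_apply]
    have hint : ∀ i, Integrable
        ({θ | ghat.pred θ (x i) ≠ σ i}.indicator (1 : ghat.Index → ℝ)) (ghat.law z) := fun i =>
      (integrable_const (1 : ℝ)).indicator (ghat.measurableSet_miss (x i) (σ i))
    simp only [hpt]
    rw [integral_add (integrable_const _) (integrable_finsetSum _ fun i _ => (hint i).const_mul _),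
      integral_const, probReal_univ, one_smul,
      integral_finsetSum _ fun i _ => (hint i).const_mul _]
    simp only [integral_const_mul, integral_indicator_one (ghat.measurableSet_miss _ _)]
    rfl
  rw [excessRisk, bestRisk_labelMeasure hμ hμ1 hξ σ x h𝒢 hx, expectedRisk]
  simp only [hin]
  have hm : Measurable fun z : Fin n → X × Bool =>
      ∑ i, μ i * (1 - ξ i) / 2 + ∑ i, μ i * ξ i * ghat.missProb (x i) (σ i) z :=
    measurable_const.add
      (Finset.measurable_fun_sum _ fun i _ => (ghat.measurable_missProb _ _).const_mul _)
  rw [integral_pi_labelMeasure hμ hμ1 hξ σ x hm]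
  simp only [mul_add, Finset.sum_add_distrib, ← Finset.sum_mul,
    sum_prod_eq_one (sum_mul_labelProb hμ1 σ) n, one_mul, add_sub_cancel_left]
  simp only [Finset.mul_sum]
  rw [Finset.sum_comm]
  exact Finset.sum_congr rfl fun i _ => Finset.sum_congr rfl fun z _ => by ring

theorem ClassEstimator.exists_avgOverlap_le_excessRisk [DecidableEq ι] (hμ : ∀ i, 0 ≤ μ i)
    (hμ1 : ∑ i, μ i = 1) (hξ : ∀ i, ξ i ∈ Set.Icc (0 : ℝ) 1) {𝒢 : Set (X → Bool)}
    (h𝒢 : ∀ g ∈ 𝒢, Measurable g) (hx : ∀ l : ι → Bool, ∃ g ∈ 𝒢, ∀ i, g (x i) = l i) :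
    ∃ P ∈ distributionsOfLevel 𝒢 (∑ i, μ i * (1 - ξ i) / 2),
      ∑ i, μ i * ξ i / 2 * avgOverlap n μ ξ i ≤ ghat.excessRisk 𝒢 P := by
  obtain ⟨σ, hσ⟩ := exists_labelling_avgOverlap_le hμ hξ
    (fun i b (z : Fin n → ι × Bool) => ghat.missProb (x i) b fun j => Prod.map x id (z j))
    (fun _ _ _ => measureReal_nonneg) (fun _ _ _ => ghat.missProb_add_not _ _ _)
  exact ⟨labelMeasure hμ hμ1 hξ σ x, ⟨isProbabilityMeasure_labelMeasure hμ hμ1 hξ σ x,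
    bestRisk_labelMeasure hμ hμ1 hξ σ x h𝒢 hx⟩,
    hσ.trans_eq (ghat.excessRisk_labelMeasure hμ hμ1 hξ σ x h𝒢 hx).symm⟩

end

/-! ### Shattered points and choices of marginal and bias. -/

theorem HasVCDimension.exists_shattered_points {X : Type u} {𝒢 : Set (X → Bool)} {V : ℕ}
    (h : HasVCDimension 𝒢 V) :
    ∃ x : Fin V → X, ∀ l : Fin V → Bool, ∃ g ∈ 𝒢, ∀ i, g (x i) = l i := by
  obtain ⟨S, hS, hsh⟩ := h.1
  let e := S.equivFinOfCardEq hS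
  have hinj : Function.Injective fun i => (e.symm i : X) :=
    Subtype.val_injective.comp e.symm.injective
  refine ⟨fun i => e.symm i, fun l => ?_⟩
  obtain ⟨g, hg, hgl⟩ := hsh (Function.extend (fun i => (e.symm i : X)) l fun _ => true)
  exact ⟨g, hg, fun i => by rw [hgl _ (e.symm i).2]; exact hinj.extend_apply l _ i⟩

/-- Points outside `T` contribute nonnegatively and are dropped; `T` will be all points, or all but
the one that tunes the best risk. -/
theorem le_sum_avgOverlap_of_const {ι : Type*} [Fintype ι] [DecidableEq ι] {μ ξ : ι → ℝ} {n : ℕ}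
    (hμ : ∀ i, 0 ≤ μ i) (hμ1 : ∑ i, μ i = 1) (hξ : ∀ i, ξ i ∈ Set.Icc (0 : ℝ) 1) (T : Finset ι)
    {p b : ℝ} (hp : ∀ i ∈ T, μ i = p) (hb : ∀ i ∈ T, ξ i = b) :
    T.card * p * b / 2 * (1 - √(n * p * b ^ 2)) ≤ ∑ i, μ i * ξ i / 2 * avgOverlap n μ ξ i ∧
    (b = 1 → T.card * p / 2 * (1 - p) ^ n ≤ ∑ i, μ i * ξ i / 2 * avgOverlap n μ ξ i) := by
  have hpos : ∀ i, 0 ≤ μ i * ξ i / 2 := fun i => by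
    have := mul_nonneg (hμ i) (hξ i).1
    positivity
  have hsub : ∑ i ∈ T, μ i * ξ i / 2 * avgOverlap n μ ξ i ≤
      ∑ i, μ i * ξ i / 2 * avgOverlap n μ ξ i :=
    Finset.sum_le_univ_sum_of_nonneg fun i => mul_nonneg (hpos i) (avgOverlap_nonneg hμ hξ i)
  refine ⟨hsub.trans' ?_, fun hb1 => hsub.trans' ?_⟩
  · calc T.card * p * b / 2 * (1 - √(n * p * b ^ 2))
        = ∑ i ∈ T, μ i * ξ i / 2 * (1 - √(n * μ i * ξ i ^ 2)) := by
          rw [Finset.sum_congr rfl fun i hi => by rw [hp i hi, hb i hi], Finset.sum_const,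
            nsmul_eq_mul]
          ring
      _ ≤ _ := Finset.sum_le_sum fun i _ =>
          mul_le_mul_of_nonneg_left (one_sub_sqrt_le_avgOverlap hμ hμ1 hξ i) (hpos i)
  · refine le_of_eq ?_
    rw [Finset.sum_congr rfl fun i hi => by
      rw [avgOverlap_of_bias_eq_one hμ1 ((hb i hi).trans hb1), hp i hi, hb i hi, hb1],
      Finset.sum_const, nsmul_eq_mul]
    ring

namespace ClassEstimator

variable {X : Type u} [MeasurableSpace X] {n m : ℕ} (ghat : ClassEstimator.{u, v} X n)
  {𝒢 : Set (X → Bool)} {x : Fin (m + 1) → X}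

/-- Lower bounds from the uniform marginal on a shattered set. -/
theorem exists_uniform_le_excessRisk (h𝒢 : ∀ g ∈ 𝒢, Measurable g)
    (hx : ∀ l : Fin (m + 1) → Bool, ∃ g ∈ 𝒢, ∀ i, g (x i) = l i) {b : ℝ}
    (hb : b ∈ Set.Icc (0 : ℝ) 1) :
    ∃ P ∈ distributionsOfLevel 𝒢 ((1 - b) / 2),
      b / 2 * (1 - √(n / ((m + 1 : ℕ) : ℝ) * b ^ 2)) ≤ ghat.excessRisk 𝒢 P ∧
      (b = 1 → 1 / 2 * (1 - 1 / ((m + 1 : ℕ) : ℝ)) ^ n ≤ ghat.excessRisk 𝒢 P) := by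
  have hV : ((m + 1 : ℕ) : ℝ) ≠ 0 := by positivity
  have hμ1 : ∑ _i : Fin (m + 1), 1 / ((m + 1 : ℕ) : ℝ) = 1 := by
    rw [Finset.sum_const, Finset.card_univ, Fintype.card_fin, nsmul_eq_mul, mul_one_div_cancel hV]
  have hμ : ∀ _i : Fin (m + 1), 0 ≤ 1 / ((m + 1 : ℕ) : ℝ) := fun _ => by positivity
  obtain ⟨P, hP, h⟩ := ghat.exists_avgOverlap_le_excessRisk x hμ hμ1 (fun _ => hb) h𝒢 hx
  obtain ⟨h1, h2⟩ := le_sum_avgOverlap_of_const (n := n) hμ hμ1 (fun _ => hb) Finset.univ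
    (fun _ _ => rfl) (fun _ _ => rfl)
  have hL : ∑ _i : Fin (m + 1), 1 / ((m + 1 : ℕ) : ℝ) * (1 - b) / 2 = (1 - b) / 2 := by
    simp only [mul_div_assoc]
    rw [← Finset.sum_mul, hμ1, one_mul]
  rw [Finset.card_univ, Fintype.card_fin, mul_one_div_cancel hV] at h1 h2
  refine ⟨P, hL ▸ hP, (h1.trans h).trans_eq' ?_, fun hb1 => (h2 hb1).trans h⟩
  rw [mul_one_div, one_mul]

/-- Lower bounds from the marginal that puts mass `p` on all points of a shattered set but one. -/
theorem exists_level_le_excessRisk (h𝒢 : ∀ g ∈ 𝒢, Measurable g)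
    (hx : ∀ l : Fin (m + 1) → Bool, ∃ g ∈ 𝒢, ∀ i, g (x i) = l i) {p b L : ℝ} (hp : 0 ≤ p)
    (hmp : m * p ≤ 1) (hb : b ∈ Set.Icc (0 : ℝ) 1) (hL : m * p * (1 - b) / 2 ≤ L)
    (hL' : L ≤ (1 - m * p * b) / 2) :
    ∃ P ∈ distributionsOfLevel 𝒢 L,
      m * p * b / 2 * (1 - √(n * p * b ^ 2)) ≤ ghat.excessRisk 𝒢 P ∧
      (b = 1 → m * p / 2 * (1 - p) ^ n ≤ ghat.excessRisk 𝒢 P) := by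
  -- `c` is the bias at the last point, of mass `1 - m * p`. The bounds on `L` say exactly that `c`
  -- fits in `[0, 1]`; if that mass is zero, they already force the level.
  obtain ⟨c, hc, hcL⟩ : ∃ c ∈ Set.Icc (0 : ℝ) 1,
      m * p * (1 - b) / 2 + (1 - m * p) * (1 - c) / 2 = L := by
    rcases hmp.eq_or_lt with h | h
    · refine ⟨1, ⟨zero_le_one, le_rfl⟩, ?_⟩
      rw [h] at hL hL' ⊢
      linarith
    · have h0 : 0 < 1 - m * p := sub_pos.2 h
      refine ⟨1 - 2 * (L - m * p * (1 - b) / 2) / (1 - m * p), ⟨?_, ?_⟩, ?_⟩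
      · rw [sub_nonneg, div_le_one h0]
        linarith
      · rw [sub_le_self_iff]
        exact div_nonneg (by linarith) h0.le
      · field_simp
        ring
  let w : Fin (m + 1) → ℝ := Fin.snoc (fun _ : Fin m => p) (1 - m * p)
  let ξ : Fin (m + 1) → ℝ := Fin.snoc (fun _ : Fin m => b) c
  have hμ : ∀ i, 0 ≤ w i := fun i => by
    refine Fin.lastCases ?_ (fun j => ?_) i
    · simpa [w] using hmp
    · simpa [w] using hp
  have hμ1 : ∑ i, w i = 1 := by
    simp [w, Fin.sum_univ_castSucc]
  have hξ : ∀ i, ξ i ∈ Set.Icc (0 : ℝ) 1 := fun i => by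
    refine Fin.lastCases ?_ (fun j => ?_) i
    · simpa [ξ] using hc
    · simpa [ξ] using hb
  obtain ⟨P, hP, h⟩ := ghat.exists_avgOverlap_le_excessRisk x hμ hμ1 hξ h𝒢 hx
  obtain ⟨h1, h2⟩ := le_sum_avgOverlap_of_const (n := n) (p := p) (b := b) hμ hμ1 hξ
    (Finset.univ.map Fin.castSuccEmb) (by simp [w]) (by simp [ξ])
  have hlev : ∑ i, w i * (1 - ξ i) / 2 = L := by
    rw [← hcL]
    simp [w, ξ, Fin.sum_univ_castSucc]
    ring
  rw [Finset.card_map, Finset.card_univ, Fintype.card_fin] at h1 h2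
  exact ⟨P, hlev ▸ hP, h1.trans h, fun hb1 => (h2 hb1).trans h⟩

/-- The noiseless case `L = 0`. -/
theorem exists_noiseless_le_excessRisk (h𝒢 : ∀ g ∈ 𝒢, Measurable g)
    (hx : ∀ l : Fin (m + 1) → Bool, ∃ g ∈ 𝒢, ∀ i, g (x i) = l i) :
    ∃ P ∈ distributionsOfLevel 𝒢 0,
      (m ≤ n + 1 → (m : ℝ) / (2 * Real.exp 1 * (n + 1)) ≤ ghat.excessRisk 𝒢 P) ∧
      (¬ m ≤ n + 1 → 1 / 2 * (1 - 1 / ((m + 1 : ℕ) : ℝ)) ^ n ≤ ghat.excessRisk 𝒢 P) := by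
  by_cases h : m ≤ n + 1
  · have hn : (0 : ℝ) < n + 1 := by positivity
    have hm : (m : ℝ) ≤ n + 1 := by exact_mod_cast h
    have hmp : (m : ℝ) * (1 / (n + 1)) ≤ 1 := by rw [mul_one_div, div_le_one hn]; exact hm
    -- `p = 1 / (n + 1)` maximises `p * (1 - p) ^ n`.
    obtain ⟨P, hP, -, hle⟩ := ghat.exists_level_le_excessRisk h𝒢 hx (p := 1 / (n + 1)) (b := 1)
      (L := 0) (by positivity) hmp ⟨zero_le_one, le_rfl⟩ (by simp) (by linarith)
    refine ⟨P, hP, fun _ => (hle rfl).trans' ?_, fun h' => absurd h h'⟩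
    have key : Real.exp (-1) ≤ (1 - 1 / ((n : ℝ) + 1)) ^ n := by
      rcases Nat.eq_zero_or_pos n with rfl | hn0
      · simp
      · have hn0' : (0 : ℝ) < n := by exact_mod_cast hn0
        have e : 1 - 1 / ((n : ℝ) + 1) = (1 + 1 / (n : ℝ))⁻¹ := by field_simp; ring
        rw [e, Real.exp_neg, inv_pow]
        refine inv_anti₀ (by positivity) ?_
        calc (1 + 1 / (n : ℝ)) ^ n ≤ Real.exp (1 / n) ^ n := by
              refine pow_le_pow_left₀ (by positivity) ?_ n
              linarith [Real.add_one_le_exp (1 / (n : ℝ))]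
          _ = Real.exp 1 := by rw [← Real.exp_nat_mul]; congr 1; field_simp
    calc (m : ℝ) / (2 * Real.exp 1 * (n + 1)) = m * (1 / (n + 1)) / 2 * Real.exp (-1) := by
          rw [Real.exp_neg]; field_simp
      _ ≤ _ := mul_le_mul_of_nonneg_left key (by positivity)
  · obtain ⟨P, hP, -, hle⟩ := ghat.exists_uniform_le_excessRisk h𝒢 hx (b := 1)
      ⟨zero_le_one, le_rfl⟩
    exact ⟨P, by simpa using hP, fun h' => absurd h' h, fun _ => hle rfl⟩

/-- The noisy case `0 < L`, for large training sets. -/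
theorem exists_noisy_le_excessRisk (h𝒢 : ∀ g ∈ 𝒢, Measurable g)
    (hx : ∀ l : Fin (m + 1) → Bool, ∃ g ∈ 𝒢, ∀ i, g (x i) = l i) (hm : 1 ≤ m) {L : ℝ}
    (hL0 : 0 < L) (hL : L ≤ 1 / 2)
    (hn : 4 / 9 ≤ (1 - 2 * L) ^ 2 * (n : ℝ) / ((m + 1 : ℕ) : ℝ)) :
    ∃ P ∈ distributionsOfLevel 𝒢 L,
      max √(L * m / (32 * n)) (2 * m / (27 * n)) ≤ ghat.excessRisk 𝒢 P := by
  have hn0 : (0 : ℝ) < n := by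
    rcases Nat.eq_zero_or_pos n with rfl | h
    · norm_num at hn
    · exact_mod_cast h
  have hm0 : (0 : ℝ) < m := by exact_mod_cast hm
  have hmn : 4 / 9 * (m : ℝ) ≤ (1 - 2 * L) ^ 2 * n := by
    rw [le_div_iff₀ (by positivity)] at hn
    push_cast at hn
    linarith
  have hB : ∃ P ∈ distributionsOfLevel 𝒢 L, 2 * m / (27 * n) ≤ ghat.excessRisk 𝒢 P := by
    have hmp : (m : ℝ) * (4 / (9 * n)) ≤ (1 - 2 * L) ^ 2 := by
      rw [mul_div_assoc', div_le_iff₀ (by positivity)]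
      linarith
    -- `p = 4 / (9 * n)` maximises `p * (1 - √(n * p))`.
    obtain ⟨P, hP, hle, -⟩ := ghat.exists_level_le_excessRisk h𝒢 hx (p := 4 / (9 * n)) (b := 1)
      (L := L) (by positivity) (by nlinarith) ⟨zero_le_one, le_rfl⟩ (by simpa using hL0.le)
      (by nlinarith)
    refine ⟨P, hP, hle.trans_eq' ?_⟩
    have : √(n * (4 / (9 * n)) * 1 ^ 2 : ℝ) = 2 / 3 := by
      rw [show (n * (4 / (9 * n)) * 1 ^ 2 : ℝ) = (2 / 3) ^ 2 by field_simp; norm_num]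
      exact Real.sqrt_sq (by norm_num)
    rw [this]
    field_simp
    norm_num
  rcases le_total (√(L * m / (32 * n))) (2 * m / (27 * n)) with hc | hc
  · rwa [max_eq_right hc]
  rw [max_eq_left hc]
  set s := √(L * m / (32 * n)) with hs
  have hs2 : s ^ 2 = L * m / (32 * n) := Real.sq_sqrt (by positivity)
  have hs0 : 0 < s := Real.sqrt_pos.2 (by positivity)
  -- This is where the root being the larger bound is used: it makes the bias `2 * s / L` at most
  -- one.
  have hLn : m ≤ 8 * n * L := by
    have h1 : (2 * m / (27 * n)) ^ 2 ≤ L * m / (32 * n) := by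
      rw [← hs2]; exact pow_le_pow_left₀ (by positivity) hc 2
    rw [div_pow, div_le_div_iff₀ (by positivity) (by positivity)] at h1
    have h2 : m * (128 * m) * n ≤ m * (729 * n * L) * n := by nlinarith
    have h3 := le_of_mul_le_mul_left (le_of_mul_le_mul_right h2 hn0) hm0
    nlinarith
  have hb2 : (2 * s / L) ^ 2 = m / (8 * n * L) := by
    rw [div_pow, mul_pow, hs2]; field_simp; norm_num
  have hb1 : 2 * s / L ≤ 1 := by
    rw [← sq_le_one_iff₀ (by positivity), hb2, div_le_one (by positivity)]
    exact hLn
  have hmp : (m : ℝ) * (2 * L / m) = 2 * L := by field_simp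
  have h4s : 4 * s ≤ 1 - 2 * L := by
    refine le_of_sq_le_sq ?_ (by linarith)
    rw [mul_pow, hs2, mul_div_assoc', div_le_iff₀ (by positivity)]
    nlinarith
  -- Total mass `2 * L` on the `m` points, with the bias making the root `1 / 2`, turns the bound
  -- into `L * b / 2 = s`.
  obtain ⟨P, hP, hle, -⟩ := ghat.exists_level_le_excessRisk h𝒢 hx (p := 2 * L / m)
    (b := 2 * s / L) (L := L) (by positivity) (by rw [hmp]; linarith) ⟨by positivity, hb1⟩
    (by
      rw [hmp]
      have : 0 ≤ 2 * L * (2 * s / L) := by positivity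
      linarith)
    (by
      rw [hmp]
      have : 2 * L * (2 * s / L) = 4 * s := by field_simp; norm_num
      linarith)
  refine ⟨P, hP, hle.trans_eq' ?_⟩
  have : √(n * (2 * L / m) * (2 * s / L) ^ 2 : ℝ) = 1 / 2 := by
    rw [hb2, show (n * (2 * L / m) * (m / (8 * n * L)) : ℝ) = (1 / 2) ^ 2 by field_simp; norm_num]
    exact Real.sqrt_sq (by norm_num)
  rw [this, hmp]
  field_simp
  norm_num

/-- The noisy case, for small training sets. -/
theorem exists_level_sixth_le_excessRisk (h𝒢 : ∀ g ∈ 𝒢, Measurable g)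
    (hx : ∀ l : Fin (m + 1) → Bool, ∃ g ∈ 𝒢, ∀ i, g (x i) = l i) {L : ℝ}
    (hL0 : 0 ≤ L) (hL : L ≤ 1 / 2)
    (hn : (1 - 2 * L) ^ 2 * (n : ℝ) / ((m + 1 : ℕ) : ℝ) ≤ 4 / 9) :
    ∃ P ∈ distributionsOfLevel 𝒢 L, (1 - 2 * L) / 6 ≤ ghat.excessRisk 𝒢 P := by
  -- The only constant bias with best risk `L`; the root is then at most `2 / 3`.
  obtain ⟨P, hP, hle, -⟩ := ghat.exists_uniform_le_excessRisk h𝒢 hx (b := 1 - 2 * L)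
    ⟨by linarith, by linarith⟩
  refine ⟨P, by convert hP using 2; ring, hle.trans' ?_⟩
  have : √(n / ((m + 1 : ℕ) : ℝ) * (1 - 2 * L) ^ 2) ≤ 2 / 3 := by
    refine Real.sqrt_le_iff.2 ⟨by norm_num, ?_⟩
    calc n / ((m + 1 : ℕ) : ℝ) * (1 - 2 * L) ^ 2 = (1 - 2 * L) ^ 2 * n / ((m + 1 : ℕ) : ℝ) := by
          ring
      _ ≤ _ := hn.trans (by norm_num)
  nlinarith

/-- The worst case over all noise levels. -/
theorem exists_le_excessRisk (h𝒢 : ∀ g ∈ 𝒢, Measurable g)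
    (hx : ∀ l : Fin (m + 1) → Bool, ∃ g ∈ 𝒢, ∀ i, g (x i) = l i) :
    ∃ P : Measure (X × Bool), IsProbabilityMeasure P ∧
      (m + 1 ≤ 4 * n → 1 / 8 * √(((m + 1 : ℕ) : ℝ) / n) ≤ ghat.excessRisk 𝒢 P) ∧
      (¬ m + 1 ≤ 4 * n → 1 / 4 ≤ ghat.excessRisk 𝒢 P) := by
  have hV : (0 : ℝ) < ((m + 1 : ℕ) : ℝ) := by positivity
  by_cases h : m + 1 ≤ 4 * n
  · have hn0 : (0 : ℝ) < n := by exact_mod_cast (by omega : 0 < n)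
    have hVn : ((m + 1 : ℕ) : ℝ) ≤ 4 * n := by exact_mod_cast h
    set s := √(((m + 1 : ℕ) : ℝ) / n) with hs
    have hs2 : s ^ 2 = ((m + 1 : ℕ) : ℝ) / n := Real.sq_sqrt (by positivity)
    have hs0 : 0 ≤ s := Real.sqrt_nonneg _
    have hs1 : s ≤ 2 := Real.sqrt_le_iff.2 ⟨by norm_num, by rw [div_le_iff₀ hn0]; linarith⟩
    -- This bias maximises `b * (1 - b / s)`; it is at most one exactly when `m + 1 ≤ 4 * n`.
    obtain ⟨P, hP, hle, -⟩ := ghat.exists_uniform_le_excessRisk h𝒢 hx (b := s / 2)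
      ⟨by linarith, by linarith⟩
    refine ⟨P, hP.1, fun _ => hle.trans_eq' ?_, fun h' => absurd h h'⟩
    have : √(n / ((m + 1 : ℕ) : ℝ) * (s / 2) ^ 2) = 1 / 2 := by
      rw [div_pow, hs2, show (n / ((m + 1 : ℕ) : ℝ) * (((m + 1 : ℕ) : ℝ) / n / 2 ^ 2) : ℝ) =
        (1 / 2) ^ 2 by field_simp]
      exact Real.sqrt_sq (by norm_num)
    rw [this]
    ring
  · have hVn : 4 * (n : ℝ) ≤ ((m + 1 : ℕ) : ℝ) := by exact_mod_cast (by omega : 4 * n ≤ m + 1)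
    obtain ⟨P, hP, hle, -⟩ := ghat.exists_uniform_le_excessRisk h𝒢 hx (b := 1)
      ⟨zero_le_one, le_rfl⟩
    refine ⟨P, hP.1, fun h' => absurd h' h, fun _ => hle.trans' ?_⟩
    have : √(n / ((m + 1 : ℕ) : ℝ) * 1 ^ 2) ≤ 1 / 2 := by
      refine Real.sqrt_le_iff.2 ⟨by norm_num, ?_⟩
      rw [one_pow, mul_one, div_le_iff₀ hV]
      linarith
    linarith

end ClassEstimator

theorem theorem8p8 {X : Type u} [MeasurableSpace X] (L : ℝ) (hL : L ∈ Set.Icc (0 : ℝ) (1 / 2))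
    (n V : ℕ) (hV : 2 ≤ V) (𝒢 : Set (X → Bool)) (h𝒢 : ∀ g ∈ 𝒢, Measurable g)
    (hVC : HasVCDimension 𝒢 V) (ghat : ClassEstimator.{u, v} X n) :
    (L = 0 → ∃ P ∈ distributionsOfLevel 𝒢 0,
      (V ≤ n + 2 → ((V : ℝ) - 1) / (2 * Real.exp 1 * ((n : ℝ) + 1)) ≤ ghat.excessRisk 𝒢 P) ∧
      (¬ V ≤ n + 2 → 1 / 2 * (1 - 1 / (V : ℝ)) ^ n ≤ ghat.excessRisk 𝒢 P)) ∧
    (0 < L → ∃ P ∈ distributionsOfLevel 𝒢 L,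
      (4 / 9 ≤ (1 - 2 * L) ^ 2 * (n : ℝ) / (V : ℝ) →
        max (Real.sqrt (L * ((V : ℝ) - 1) / (32 * (n : ℝ)))) (2 * ((V : ℝ) - 1) / (27 * (n : ℝ)))
          ≤ ghat.excessRisk 𝒢 P) ∧
      (¬ 4 / 9 ≤ (1 - 2 * L) ^ 2 * (n : ℝ) / (V : ℝ) →
        (1 - 2 * L) / 6 ≤ ghat.excessRisk 𝒢 P)) ∧
    (∃ P : Measure (X × Bool), IsProbabilityMeasure P ∧
      (V ≤ 4 * n → 1 / 8 * Real.sqrt ((V : ℝ) / (n : ℝ)) ≤ ghat.excessRisk 𝒢 P) ∧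
      (¬ V ≤ 4 * n → 1 / 4 ≤ ghat.excessRisk 𝒢 P)) := by
  obtain ⟨x, hx⟩ := hVC.exists_shattered_points
  obtain ⟨m, rfl⟩ : ∃ m, V = m + 1 := ⟨V - 1, by omega⟩
  have hm : ((m + 1 : ℕ) : ℝ) - 1 = m := by push_cast; ring
  rw [hm]
  refine ⟨fun _ => ?_, fun hL0 => ?_, ghat.exists_le_excessRisk h𝒢 hx⟩
  · obtain ⟨P, hP, h1, h2⟩ := ghat.exists_noiseless_le_excessRisk h𝒢 hx
    exact ⟨P, hP, fun h => h1 (by omega), fun h => h2 (by omega)⟩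
  · by_cases h : 4 / 9 ≤ (1 - 2 * L) ^ 2 * (n : ℝ) / ((m + 1 : ℕ) : ℝ)
    · obtain ⟨P, hP, hle⟩ := ghat.exists_noisy_le_excessRisk h𝒢 hx (by omega) hL0 hL.2 h
      exact ⟨P, hP, fun _ => hle, fun h' => absurd h h'⟩
    · obtain ⟨P, hP, hle⟩ := ghat.exists_level_sixth_le_excessRisk h𝒢 hx hL.1 hL.2
        (not_le.1 h).le
      exact ⟨P, hP, fun h' => absurd h' h, fun _ => hle⟩
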